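/- Fix a countably infinite data domain $\mathbb D$ with equality as its only predicate. A trace is an infinite sequence $t\in\mathbb D^\omega$. Constraints are given by $b ::= \mathsf{true}\mid e=f\mid \neg b\mid b\wedge b$, where $e,f$ are data variables or the placeholder $\star$ for the current element of the trace. The formulae of $\mathrm{recHML}^d$ are the closed formulae (no free data variable and no free formula variable) of $$\varphi ::= \mathsf{tt}\mid\mathsf{ff}\mid\langle b\rangle\varphi\mid[b]\varphi\mid\exists x.\varphi\mid\forall x.\varphi\mid\varphi\vee\varphi\mid\varphi\wedge\varphi\mid\min X.\varphi\mid\max X.\varphi\mid X$$ in which every occurrence of a fixed-point variable is in the scope of a modality ($\langle b\rangle$ or $[b]$) inside its defining fixed-point formula. Semantics. Given an environment $\delta$ assigning data values to data variables and an environment $\rho$ assigning to each formula variable a map from data environments to sets of traces, $[\![\varphi,\rho,\delta]\!]\subseteq\mathbb D^\omega$ is defined as follows: $\mathsf{tt},\mathsf{ff}$ denote $\mathbb D^\omega$ and $\varnothing$; $\vee,\wedge$ denote union and intersection; a trace $du$ satisfies $\langle b\rangle\varphi$ if $b$ holds under $\delta[\star\mapsto d]$ and $u\in[\![\varphi,\rho,\delta]\!]$,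 and satisfies $[b]\varphi$ if, whenever $b$ holds under $\delta[\star\mapsto d]$, $u\in[\![\varphi,\rho,\delta]\!]$; $\exists x.\varphi$ and $\forall x.\varphi$ denote $\bigcup_{d}[\![\varphi,\rho,\delta[x\mapsto d]]\!]$ and $\bigcap_{d}[\![\varphi,\rho,\delta[x\mapsto d]]\!]$; $[\![X,\rho,\delta]\!]=\rho(X)(\delta)$; and $\min X.\varphi$, $\max X.\varphi$ denote the value at $\delta$ of the least, respectively greatest, fixed point of $F\mapsto\big(\delta'\mapsto[\![\varphi,\rho[X\mapsto F],\delta']\!]\big)$ for the pointwise inclusion order. Two formulae are equivalent if they have the same semantics. For classes $\mathcal L_1,\mathcal L_2$ of formulae, $\mathcal L_1\sqsubseteq\mathcal L_2$ means that every formula of $\mathcal L_1$ is equivalent to some formula of $\mathcal L_2$, and $\mathcal L_1\sqsubsetneq\mathcal L_2$ means that $\mathcal L_1\sqsubseteq\mathcal L_2$ but not $\mathcal L_2\sqsubseteq\mathcal L_1$. Fragments. For a set $\mathcal C$ of constructs, $\mathrm{HML}^d(\mathcal C)$ is the set of formulae of $\mathrm{recHML}^d$ built from the constructs in $\mathcal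 C$ (and formula variables). $\mathrm{HML}^d(\mathcal C,\mathrm{match})$ consists of those in which every existential quantifier occurs in the form $\exists x.\langle x=\star\wedge b\rangle\varphi$. $\mathrm{HML}^d(\mathcal C,\mathrm{det})$ consists of those formulae of $\mathrm{HML}^d(\mathcal C,\mathrm{match})$ in which, moreover, every disjunction is of the form $\bigvee_{i\in I}\exists x.\langle x=\star\wedge b_i\rangle\varphi_i$ with $b_i\wedge b_j$ unsatisfiable for all $i\ne j$. Theorem. The following hierarchy is strict: $$\begin{aligned}\mathrm{HML}^d(\mathsf{tt},\exists,\langle\rangle,\vee,\mathrm{det}) &\sqsubsetneq \mathrm{HML}^d(\mathsf{tt},\min,\exists,\langle\rangle,\vee,\mathrm{det})\\ &\sqsubsetneq \mathrm{HML}^d(\mathsf{tt},\min,\exists,\langle\rangle,\vee,\mathrm{match})\\ &\sqsubsetneq \mathrm{HML}^d(\mathsf{tt},\min,\exists,\langle\rangle,\vee)\\ &\sqsubsetneq \mathrm{HML}^d(\mathsf{tt},\min,\exists,\langle\rangle,\vee,\wedge)\\ &\sqsubsetneq \mathrm{HML}^d(\mathsf{tt},\mathsf{ff},\min,\max,\exists,\forall,\langle\rangle,[\,],\vee,\wedge)=\mathrm{recHML}^d.\end{aligned}$$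 In particular, the deterministic fragment with recursion, $\mathrm{HML}^d(\mathsf{tt},\min,\exists,\langle\rangle,\vee,\mathrm{det})$, is strictly less expressive than the disjunctive fragment $\mathrm{HML}^d(\mathsf{tt},\min,\exists,\langle\rangle,\vee)$ and than the fragment with conjunction $\mathrm{HML}^d(\mathsf{tt},\min,\exists,\langle\rangle,\vee,\wedge)$. -/

import Mathlib

namespace RecHMLd

/-- Expressions: a data variable (named by a natural number) or the placeholder `⋆` for the
current element of the trace. -/
inductive DExp where
  | var (x : ℕ)
  | star

/-- Boolean constraint expressions. -/
inductive BExp where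
  | true
  | eq (e f : DExp)
  | neg (b : BExp)
  | and (b c : BExp)

/-- Formulae of the logic. Data variables and formula variables are named by natural numbers. -/
inductive Formula where
  | tt
  | ff
  | dia (b : BExp) (φ : Formula)
  | box (b : BExp) (φ : Formula)
  | ex (x : ℕ) (φ : Formula)
  | all (x : ℕ) (φ : Formula)
  | or (φ ψ : Formula)
  | and (φ ψ : Formula)
  | min (X : ℕ) (φ : Formula)
  | max (X : ℕ) (φ : Formula)
  | fvar (X : ℕ)

/-! ### Semantics over infinite traces -/

section Semantics

variable {D : Type*}

/-- Value of an expression when the data variables are given by `δ` and the current element of the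
trace is `d`. -/
def DExp.eval (δ : ℕ → D) (d : D) : DExp → D
  | .var x => δ x
  | .star => d

/-- Truth of a constraint `b` under `δ[⋆ ↦ d]`. -/
def BExp.Holds (δ : ℕ → D) (d : D) : BExp → Prop
  | .true => True
  | .eq e f => e.eval δ d = f.eval δ d
  | .neg b => ¬ b.Holds δ d
  | .and b c => b.Holds δ d ∧ c.Holds δ d

/-- Data interpretations: they map a data environment to a set of infinite traces. They form a
complete lattice for the pointwise order. -/
abbrev DInt (D : Type*) := (ℕ → D) → Set (ℕ → D)

/-- The tail `u` of a trace `t = d u`. -/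
def tail (t : ℕ → D) : ℕ → D := fun n => t (n + 1)

/-- Denotational linear-time semantics; `ρ` interprets the formula variables and `δ` the data
variables. -/
def Formula.sem : Formula → (ℕ → DInt D) → DInt D
  | .tt, _, _ => Set.univ
  | .ff, _, _ => ∅
  | .dia b φ, ρ, δ => {t | b.Holds δ (t 0) ∧ tail t ∈ φ.sem ρ δ}
  | .box b φ, ρ, δ => {t | b.Holds δ (t 0) → tail t ∈ φ.sem ρ δ}
  | .ex x φ, ρ, δ => ⋃ d : D, φ.sem ρ (Function.update δ x d)
  | .all x φ, ρ, δ => ⋂ d : D, φ.sem ρ (Function.update δ x d)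
  | .or φ ψ, ρ, δ => φ.sem ρ δ ∪ ψ.sem ρ δ
  | .and φ ψ, ρ, δ => φ.sem ρ δ ∩ ψ.sem ρ δ
  | .min X φ, ρ, δ => sInf {F : DInt D | φ.sem (Function.update ρ X F) ≤ F} δ
  | .max X φ, ρ, δ => sSup {F : DInt D | F ≤ φ.sem (Function.update ρ X F)} δ
  | .fvar X, ρ, δ => ρ X δ

end Semantics

/-! ### Closed and guarded formulae -/

/-- Data variables of an expression. -/
def DExp.vars : DExp → Set ℕ
  | .var x => {x}
  | .star => ∅

/-- Data variables of a constraint. -/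
def BExp.vars : BExp → Set ℕ
  | .true => ∅
  | .eq e f => e.vars ∪ f.vars
  | .neg b => b.vars
  | .and b c => b.vars ∪ c.vars

/-- Free data variables, bound by the quantifiers. -/
def Formula.freeData : Formula → Set ℕ
  | .tt => ∅
  | .ff => ∅
  | .dia b φ => b.vars ∪ φ.freeData
  | .box b φ => b.vars ∪ φ.freeData
  | .ex x φ => φ.freeData \ {x}
  | .all x φ => φ.freeData \ {x}
  | .or φ ψ => φ.freeData ∪ ψ.freeData
  | .and φ ψ => φ.freeData ∪ ψ.freeData
  | .min _ φ => φ.freeData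
  | .max _ φ => φ.freeData
  | .fvar _ => ∅

/-- Free formula variables, bound by the fixed points. -/
def Formula.freeRec : Formula → Set ℕ
  | .tt => ∅
  | .ff => ∅
  | .dia _ φ => φ.freeRec
  | .box _ φ => φ.freeRec
  | .ex _ φ => φ.freeRec
  | .all _ φ => φ.freeRec
  | .or φ ψ => φ.freeRec ∪ ψ.freeRec
  | .and φ ψ => φ.freeRec ∪ ψ.freeRec
  | .min X φ => φ.freeRec \ {X}
  | .max X φ => φ.freeRec \ {X}
  | .fvar X => {X}

/-- Formula variables with a free occurrence that is not in the scope of a modality. -/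
def Formula.unguarded : Formula → Set ℕ
  | .tt => ∅
  | .ff => ∅
  | .dia _ _ => ∅
  | .box _ _ => ∅
  | .ex _ φ => φ.unguarded
  | .all _ φ => φ.unguarded
  | .or φ ψ => φ.unguarded ∪ ψ.unguarded
  | .and φ ψ => φ.unguarded ∪ ψ.unguarded
  | .min X φ => φ.unguarded \ {X}
  | .max X φ => φ.unguarded \ {X}
  | .fvar X => {X}

/-- Every occurrence of a fixed-point variable is in the scope of a modality inside its defining
fixed-point formula. -/
def Formula.Guarded : Formula → Prop
  | .tt => True
  | .ff => True
  | .dia _ φ => φ.Guarded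
  | .box _ φ => φ.Guarded
  | .ex _ φ => φ.Guarded
  | .all _ φ => φ.Guarded
  | .or φ ψ => φ.Guarded ∧ ψ.Guarded
  | .and φ ψ => φ.Guarded ∧ ψ.Guarded
  | .min X φ => X ∉ φ.unguarded ∧ φ.Guarded
  | .max X φ => X ∉ φ.unguarded ∧ φ.Guarded
  | .fvar _ => True

/-- The full logic: closed formulae with guarded recursion. -/
def recHMLd : Set Formula :=
  {φ | φ.freeData = ∅ ∧ φ.freeRec = ∅ ∧ φ.Guarded}

/-! ### Fragments -/

/-- The constructs that a fragment may allow. -/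
inductive Construct where
  | tt | ff | dia | box | ex | all | or | and | min | max

/-- All constructs that occur in the formula belong to `C`. -/
def Formula.Uses (C : Set Construct) : Formula → Prop
  | .tt => Construct.tt ∈ C
  | .ff => Construct.ff ∈ C
  | .dia _ φ => Construct.dia ∈ C ∧ φ.Uses C
  | .box _ φ => Construct.box ∈ C ∧ φ.Uses C
  | .ex _ φ => Construct.ex ∈ C ∧ φ.Uses C
  | .all _ φ => Construct.all ∈ C ∧ φ.Uses C
  | .or φ ψ => Construct.or ∈ C ∧ φ.Uses C ∧ ψ.Uses C
  | .and φ ψ => Construct.and ∈ C ∧ φ.Uses C ∧ ψ.Uses C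
  | .min _ φ => Construct.min ∈ C ∧ φ.Uses C
  | .max _ φ => Construct.max ∈ C ∧ φ.Uses C
  | .fvar _ => True

/-- The fragment of the logic with the constructs in `C`. -/
def HMLd (C : Set Construct) : Set Formula :=
  {φ | φ ∈ recHMLd ∧ φ.Uses C}

/-- The formula `∃x. ⟨x = ⋆ ∧ b⟩ φ`. -/
def matchEx (x : ℕ) (b : BExp) (φ : Formula) : Formula :=
  .ex x (.dia (.and (.eq (.var x) .star) b) φ)

/-- Every existential quantifier occurs in the form `∃x. ⟨x = ⋆ ∧ b⟩ φ`. -/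
def Formula.IsMatch : Formula → Prop
  | .tt => True
  | .ff => True
  | .dia _ φ => φ.IsMatch
  | .box _ φ => φ.IsMatch
  | .ex x φ => (∃ b ψ, Formula.ex x φ = matchEx x b ψ) ∧ φ.IsMatch
  | .all _ φ => φ.IsMatch
  | .or φ ψ => φ.IsMatch ∧ ψ.IsMatch
  | .and φ ψ => φ.IsMatch ∧ ψ.IsMatch
  | .min _ φ => φ.IsMatch
  | .max _ φ => φ.IsMatch
  | .fvar _ => True

/-- A constraint is satisfiable over the data domain `D`. -/
def BExp.Satisfiable (D : Type*) (b : BExp) : Prop :=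
  ∃ (δ : ℕ → D) (d : D), b.Holds δ d

/-- The disjuncts `φ₁, …, φₙ` of a formula read as an iterated disjunction `φ₁ ∨ ⋯ ∨ φₙ`. -/
def Formula.disjuncts : Formula → List Formula
  | .or φ ψ => φ.disjuncts ++ ψ.disjuncts
  | φ => [φ]

/-- The formula is an iterated disjunction of formulae `∃x. ⟨x = ⋆ ∧ bᵢ⟩ φᵢ` in which the
constraints `bᵢ` are pairwise incompatible. -/
def Formula.IsDetDisj (D : Type*) (φ : Formula) : Prop :=
  ∃ (x : ℕ) (l : List (BExp × Formula)),
    φ.disjuncts = l.map (fun p => matchEx x p.1 p.2) ∧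
    l.Pairwise (fun p q => ¬ (BExp.and p.1 q.1).Satisfiable D)

/-- All disjunctions that occur in the formula are deterministic. -/
def Formula.DisjDet (D : Type*) : Formula → Prop
  | .tt => True
  | .ff => True
  | .dia _ φ => φ.DisjDet D
  | .box _ φ => φ.DisjDet D
  | .ex _ φ => φ.DisjDet D
  | .all _ φ => φ.DisjDet D
  | .or φ ψ => (Formula.or φ ψ).IsDetDisj D ∧ φ.DisjDet D ∧ ψ.DisjDet D
  | .and φ ψ => φ.DisjDet D ∧ ψ.DisjDet D
  | .min _ φ => φ.DisjDet D
  | .max _ φ => φ.DisjDet D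
  | .fvar _ => True

/-- The fragment with the constructs in `C`, under the restriction `match`. -/
def HMLdMatch (C : Set Construct) : Set Formula :=
  {φ | φ ∈ HMLd C ∧ φ.IsMatch}

/-- The fragment with the constructs in `C`, under the restriction `det`. -/
def HMLdDet (D : Type*) (C : Set Construct) : Set Formula :=
  {φ | φ ∈ HMLdMatch C ∧ φ.DisjDet D}

/-! ### Expressiveness -/

/-- Two formulae are equivalent over the data domain `D`. -/
def Equivalent (D : Type*) (φ ψ : Formula) : Prop :=
  ∀ (ρ : ℕ → DInt D) (δ : ℕ → D), φ.sem ρ δ = ψ.sem ρ δ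

/-- Every formula of `L₁` is equivalent to some formula of `L₂`. -/
def ExpressibleIn (D : Type*) (L₁ L₂ : Set Formula) : Prop :=
  ∀ φ ∈ L₁, ∃ ψ ∈ L₂, Equivalent D φ ψ

/-- `L₁` is strictly less expressive than `L₂`. -/
def StrictlyLess (D : Type*) (L₁ L₂ : Set Formula) : Prop :=
  ExpressibleIn D L₁ L₂ ∧ ¬ ExpressibleIn D L₂ L₁

end RecHMLd

namespace RecHMLd

variable {D : Type*}

/-! ### Monotonicity and fixed points -/

/-! The inclusions are syntactic. Each separation exhibits a formula that violates an invariant of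
the smaller fragment.

Constraints test only equality, so permuting the data domain preserves satisfaction (`sem_permRel`).
Without conjunction, a trace is accepted along a single run. After any number of steps that run
knows the past only through the values of the finitely many data variables, so the rest of the trace
may be permuted by any permutation fixing these stored values (`sem_keeps`). Once more elements have
been read than there are variables, some element read is forgotten. How the store may arise
separates the fragments. - With unrestricted `∃`, the store may contain guessed future values, but a
forgotten value can still be smuggled into the future. This defeats `distinctUntilRecurs`, where
conjunction runs one check per element read. - Under `match`, the store comes from the initial
environment and the prefix read, so a fresh value can be swapped with a forgotten one. This defeats
`freshDouble`, which guesses the fresh value. - Under `det`, the store is a function of the initial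
environment and the prefix (`sem_detKeeps`), so the continuation can be chosen to repeat a forgotten
element. This defeats `someRecurs`, which guesses the element to remember.

The two ends of the chain are topological: without fixed points a bounded prefix decides membership
(`exists_lookahead`), and the fragment with `∧` defines only open sets of traces (`sem_prefixOpen`),
whereas the constant traces are not open. -/

theorem Formula.sem_mono (φ : Formula) :
    ∀ {ρ₁ ρ₂ : ℕ → DInt D}, ρ₁ ≤ ρ₂ → φ.sem ρ₁ ≤ φ.sem ρ₂ := by
  have upd : ∀ {ρ₁ ρ₂ : ℕ → DInt D}, ρ₁ ≤ ρ₂ → ∀ (X : ℕ) (F : DInt D),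
      Function.update ρ₁ X F ≤ Function.update ρ₂ X F := fun h X F =>
    update_le_update_iff.2 ⟨le_rfl, fun j _ => h j⟩
  induction φ with
  | tt => intro _ _ _ δ t ht; exact ht
  | ff => intro _ _ _ δ t ht; exact ht
  | dia b φ ih => intro _ _ h δ t ht; exact ⟨ht.1, ih h δ ht.2⟩
  | box b φ ih => intro _ _ h δ t ht; exact fun hb => ih h δ (ht hb)
  | ex x φ ih =>
    intro _ _ h δ t ht
    obtain ⟨d, hd⟩ := Set.mem_iUnion.1 ht
    exact Set.mem_iUnion.2 ⟨d, ih h _ hd⟩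
  | all x φ ih =>
    intro _ _ h δ t ht
    exact Set.mem_iInter.2 fun d => ih h _ (Set.mem_iInter.1 ht d)
  | or φ ψ ih₁ ih₂ => intro _ _ h δ t ht; exact ht.imp (fun h' => ih₁ h δ h') (fun h' => ih₂ h δ h')
  | and φ ψ ih₁ ih₂ => intro _ _ h δ t ht; exact ⟨ih₁ h δ ht.1, ih₂ h δ ht.2⟩
  | min X φ ih =>
    intro ρ₁ ρ₂ h
    exact sInf_le_sInf fun F (hF : φ.sem (Function.update ρ₂ X F) ≤ F) => (ih (upd h X F)).trans hF
  | max X φ ih =>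
    intro ρ₁ ρ₂ h
    exact sSup_le_sSup fun F (hF : F ≤ φ.sem (Function.update ρ₁ X F)) => hF.trans (ih (upd h X F))
  | fvar X => intro _ _ h; exact h X

theorem Formula.update_mono (ρ : ℕ → DInt D) (X : ℕ) {F G : DInt D} (h : F ≤ G) :
    Function.update ρ X F ≤ Function.update ρ X G :=
  update_le_update_iff.2 ⟨h, fun _ _ => le_rfl⟩

theorem Formula.sem_min_le {X : ℕ} {φ : Formula} {ρ : ℕ → DInt D} {F : DInt D}
    (h : φ.sem (Function.update ρ X F) ≤ F) : (Formula.min X φ).sem ρ ≤ F :=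
  sInf_le h

theorem Formula.sem_min_prefixed (X : ℕ) (φ : Formula) (ρ : ℕ → DInt D) :
    φ.sem (Function.update ρ X ((Formula.min X φ).sem ρ)) ≤ (Formula.min X φ).sem ρ :=
  le_sInf fun _ hF => (φ.sem_mono (update_mono ρ X (sem_min_le hF))).trans hF

theorem Formula.sem_min_eq (X : ℕ) (φ : Formula) (ρ : ℕ → DInt D) :
    φ.sem (Function.update ρ X ((Formula.min X φ).sem ρ)) = (Formula.min X φ).sem ρ :=
  le_antisymm (sem_min_prefixed X φ ρ)
    (sem_min_le (φ.sem_mono (update_mono ρ X (sem_min_prefixed X φ ρ))))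

theorem Formula.le_sem_max {X : ℕ} {φ : Formula} {ρ : ℕ → DInt D} {F : DInt D}
    (h : F ≤ φ.sem (Function.update ρ X F)) : F ≤ (Formula.max X φ).sem ρ :=
  le_sSup (a := F) h

theorem Formula.sem_max_postfixed (X : ℕ) (φ : Formula) (ρ : ℕ → DInt D) :
    (Formula.max X φ).sem ρ ≤ φ.sem (Function.update ρ X ((Formula.max X φ).sem ρ)) :=
  sSup_le fun _ hF => le_trans hF (φ.sem_mono (update_mono ρ X (le_sem_max hF)))

/-! ### Data variables and permutations of the data domain -/

/-- Finset version of the variables of an expression. -/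
def DExp.dataVars : DExp → Finset ℕ
  | .var x => {x}
  | .star => ∅

/-- Finset version of the variables of a constraint. -/
def BExp.dataVars : BExp → Finset ℕ
  | .true => ∅
  | .eq e f => e.dataVars ∪ f.dataVars
  | .neg b => b.dataVars
  | .and b c => b.dataVars ∪ c.dataVars

/-- The data variables that occur in the constraints of a formula. -/
def Formula.dataVars : Formula → Finset ℕ
  | .tt => ∅
  | .ff => ∅
  | .dia b φ => b.dataVars ∪ φ.dataVars
  | .box b φ => b.dataVars ∪ φ.dataVars
  | .ex _ φ => φ.dataVars
  | .all _ φ => φ.dataVars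
  | .or φ ψ => φ.dataVars ∪ ψ.dataVars
  | .and φ ψ => φ.dataVars ∪ ψ.dataVars
  | .min _ φ => φ.dataVars
  | .max _ φ => φ.dataVars
  | .fvar _ => ∅

theorem DExp.eval_perm (π : Equiv.Perm D) {V : Finset ℕ} {δ δ' : ℕ → D}
    (h : ∀ x ∈ V, δ' x = π (δ x)) (d : D) {e : DExp} (he : e.dataVars ⊆ V) :
    e.eval δ' (π d) = π (e.eval δ d) := by
  cases e with
  | var x => exact h x (he (Finset.mem_singleton_self x))
  | star => rfl

theorem BExp.holds_perm (π : Equiv.Perm D) {V : Finset ℕ} {δ δ' : ℕ → D}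
    (h : ∀ x ∈ V, δ' x = π (δ x)) (d : D) {b : BExp} (hb : b.dataVars ⊆ V) :
    b.Holds δ' (π d) ↔ b.Holds δ d := by
  induction b with
  | true => exact Iff.rfl
  | eq e f =>
    obtain ⟨he, hf⟩ := Finset.union_subset_iff.1 hb
    simp only [BExp.Holds, DExp.eval_perm π h d he, DExp.eval_perm π h d hf, π.injective.eq_iff]
  | neg b ih => exact not_congr (ih hb)
  | and b c ih₁ ih₂ =>
    obtain ⟨h₁, h₂⟩ := Finset.union_subset_iff.1 hb
    exact and_congr (ih₁ h₁) (ih₂ h₂)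

/-- Applying `π` to environments (on `V`) and traces maps `G` into `F`. -/
def PermRel (V : Finset ℕ) (π : Equiv.Perm D) (G F : DInt D) : Prop :=
  ∀ δ δ' : ℕ → D, (∀ x ∈ V, δ' x = π (δ x)) → ∀ t ∈ G δ, π ∘ t ∈ F δ'

/-- Equality constraints do not distinguish a valuation from its image under `π`, and a quantifier
witness `d` is transported to `π d`. Two interpretations are needed because the fixed-point step
relates an auxiliary `G` to the fixed point. -/
theorem Formula.sem_permRel {V : Finset ℕ} (π : Equiv.Perm D) {φ : Formula}
    (hU : φ.Uses {.tt, .min, .ex, .dia, .or}) (hV : φ.dataVars ⊆ V) {ρ₁ ρ₂ : ℕ → DInt D}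
    (hρ : ∀ X, PermRel V π (ρ₁ X) (ρ₂ X)) : PermRel V π (φ.sem ρ₁) (φ.sem ρ₂) := by
  induction φ generalizing ρ₁ ρ₂ with
  | tt => intro _ _ _ _ _; trivial
  | ff | box | all | and | max => simp [Formula.Uses] at hU
  | dia b φ ih =>
    obtain ⟨h₁, h₂⟩ := Finset.union_subset_iff.1 hV
    intro δ δ' h t ht
    exact ⟨(BExp.holds_perm π h _ h₁).2 ht.1, ih hU.2 h₂ hρ δ δ' h _ ht.2⟩
  | ex x φ ih =>
    intro δ δ' h t ht
    obtain ⟨d, hd⟩ := Set.mem_iUnion.1 ht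
    refine Set.mem_iUnion.2 ⟨π d, ih hU.2 hV hρ _ _ (fun y hy => ?_) _ hd⟩
    by_cases hyx : y = x
    · subst hyx; simp
    · simp [hyx, h y hy]
  | or φ ψ ih₁ ih₂ =>
    obtain ⟨h₁, h₂⟩ := Finset.union_subset_iff.1 hV
    intro δ δ' h t ht
    exact ht.imp (ih₁ hU.2.1 h₁ hρ δ δ' h t) (ih₂ hU.2.2 h₂ hρ δ δ' h t)
  | min X φ ih =>
    let F := (Formula.min X φ).sem ρ₂
    -- The largest interpretation related to `F`. Showing that it is a prefixed point bounds the
    -- least fixed point by it.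
    let G : DInt D := fun δ => {t | ∀ δ', (∀ x ∈ V, δ' x = π (δ x)) → π ∘ t ∈ F δ'}
    have hG : (Formula.min X φ).sem ρ₁ ≤ G := by
      refine sem_min_le fun δ t ht δ' h => ?_
      refine sem_min_prefixed X φ ρ₂ δ' (ih hU.2 hV (fun Y => ?_) δ δ' h t ht)
      by_cases hY : Y = X
      · subst hY
        simp only [Function.update_self]
        exact fun _ δ' h' _ ht' => ht' δ' h'
      · simpa [hY] using hρ Y
    exact fun δ δ' h t ht => hG δ ht δ' h
  | fvar X => exact hρ X

/-- The trace that follows `w` for the first `m` elements and then `u`. -/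
def splice (m : ℕ) (w u : ℕ → D) : ℕ → D := fun p => if p < m then w p else u p

@[simp] theorem splice_zero (w u : ℕ → D) : splice 0 w u = u := by
  funext p; simp [splice]

@[simp] theorem tail_splice (m : ℕ) (w u : ℕ → D) :
    tail (splice (m + 1) w u) = splice m (tail w) (tail u) := by
  funext p; simp [splice, tail]

@[simp] theorem splice_succ_apply_zero (m : ℕ) (w u : ℕ → D) : splice (m + 1) w u 0 = w 0 := by
  simp [splice]

theorem tail_comp (π : Equiv.Perm D) (t : ℕ → D) : tail (π ∘ t) = π ∘ tail t := rfl

/-! ### Finite memory of disjunctive formulae -/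

/-- After any number of steps there is a data environment such that permuting the rest of a trace
of `G` by a permutation that fixes its values on `V` gives a trace of `F`. Under `R`, these values
stem from the initial environment and the part of the trace that was read. -/
def Keeps (R : Prop) (V : Finset ℕ) (G F : DInt D) : Prop :=
  ∀ (m : ℕ) (δ t : ℕ → D), t ∈ G δ → ∃ δ' : ℕ → D,
    (R → ∀ x ∈ V, (∃ y ∈ V, δ' x = δ y) ∨ ∃ p < m, δ' x = t p) ∧
    ∀ π : Equiv.Perm D, (∀ x ∈ V, π (δ' x) = δ' x) → splice m t (π ∘ t) ∈ F δ

theorem Formula.matchEx_holds {x : ℕ} {φ : Formula} (h : (Formula.ex x φ).IsMatch)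
    {ρ : ℕ → DInt D} {δ t : ℕ → D} {d : D} (ht : t ∈ φ.sem ρ (Function.update δ x d)) :
    d = t 0 := by
  obtain ⟨⟨b, ψ, hb⟩, _⟩ := h
  simp only [matchEx, Formula.ex.injEq, true_and] at hb
  subst hb
  simpa [BExp.Holds, DExp.eval] using ht.1.1

/-- Without conjunction, satisfaction follows one run. Its environment after `m` steps is the
required `δ'`, and `sem_permRel` applies to the rest of the trace from there. The proposition `R`
switches the origin of the stored values on exactly when the quantifiers are matched. -/
theorem Formula.sem_keeps {R : Prop} {V : Finset ℕ} {φ : Formula}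
    (hU : φ.Uses {.tt, .min, .ex, .dia, .or}) (hV : φ.dataVars ⊆ V) (hM : R → φ.IsMatch)
    {ρ₁ ρ₂ : ℕ → DInt D} (hle : ρ₁ ≤ ρ₂) (hρ : ∀ π X, PermRel V π (ρ₂ X) (ρ₂ X))
    (hK : ∀ X, Keeps R V (ρ₁ X) (ρ₂ X)) : Keeps R V (φ.sem ρ₁) (φ.sem ρ₂) := by
  induction φ generalizing ρ₁ ρ₂ with
  | tt => exact fun m δ t _ => ⟨δ, fun _ x hx => .inl ⟨x, hx, rfl⟩, fun _ _ => trivial⟩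
  | ff | box | all | and | max => simp [Formula.Uses] at hU
  | dia b φ ih =>
    intro m δ t ht
    cases m with
    | zero =>
      refine ⟨δ, fun _ x hx => .inl ⟨x, hx, rfl⟩, fun π h => ?_⟩
      rw [splice_zero]
      exact sem_permRel π hU hV (hρ π) δ δ (fun x hx => (h x hx).symm) t (sem_mono _ hle δ ht)
    | succ m =>
      obtain ⟨δ', h₁, h₂⟩ :=
        ih hU.2 (Finset.union_subset_iff.1 hV).2 hM hle hρ hK m δ (tail t) ht.2
      refine ⟨δ', fun r x hx => (h₁ r x hx).imp_right ?_, fun π h => ?_⟩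
      · rintro ⟨p, hp, e⟩
        exact ⟨p + 1, by omega, e⟩
      · refine ⟨by simpa using ht.1, ?_⟩
        rw [tail_splice, tail_comp]
        exact h₂ π h
  | ex x φ ih =>
    intro m δ t ht
    -- For `m = 0` the quantifier is not opened: under `match` its witness is `t 0`, which has not
    -- been read yet.
    cases m with
    | zero =>
      refine ⟨δ, fun _ x hx => .inl ⟨x, hx, rfl⟩, fun π h => ?_⟩
      rw [splice_zero]
      exact sem_permRel π hU hV (hρ π) δ δ (fun x hx => (h x hx).symm) t (sem_mono _ hle δ ht)
    | succ m =>
      obtain ⟨d, hd⟩ := Set.mem_iUnion.1 ht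
      obtain ⟨δ', h₁, h₂⟩ := ih hU.2 hV (fun r => (hM r).2) hle hρ hK (m + 1) _ t hd
      refine ⟨δ', fun r y hy => ?_, fun π h => Set.mem_iUnion.2 ⟨d, h₂ π h⟩⟩
      have hdt := matchEx_holds (hM r) hd
      rcases h₁ r y hy with ⟨z, hz, e⟩ | h
      · by_cases hzx : z = x
        · exact .inr ⟨0, by omega, by rw [e, hzx, Function.update_self, hdt]⟩
        · exact .inl ⟨z, hz, by rw [e, Function.update_of_ne hzx]⟩
      · exact .inr h
  | or φ ψ ih₁ ih₂ =>
    obtain ⟨v₁, v₂⟩ := Finset.union_subset_iff.1 hV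
    rintro m δ t (ht | ht)
    · obtain ⟨δ', h₁, h₂⟩ := ih₁ hU.2.1 v₁ (fun r => (hM r).1) hle hρ hK m δ t ht
      exact ⟨δ', h₁, fun π h => .inl (h₂ π h)⟩
    · obtain ⟨δ', h₁, h₂⟩ := ih₂ hU.2.2 v₂ (fun r => (hM r).2) hle hρ hK m δ t ht
      exact ⟨δ', h₁, fun π h => .inr (h₂ π h)⟩
  | min X φ ih =>
    let F := (Formula.min X φ).sem ρ₂
    -- The part of the fixed point `F` on which the claim holds. Intersecting with `F` gives the
    -- comparison `G ≤ F` that the induction hypothesis needs.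
    let G : DInt D := fun δ => {t | t ∈ F δ ∧ ∀ m, ∃ δ' : ℕ → D,
      (R → ∀ x ∈ V, (∃ y ∈ V, δ' x = δ y) ∨ ∃ p < m, δ' x = t p) ∧
      ∀ π : Equiv.Perm D, (∀ x ∈ V, π (δ' x) = δ' x) → splice m t (π ∘ t) ∈ F δ}
    have hGF : G ≤ F := fun δ t ht => ht.1
    have hF : φ.sem (Function.update ρ₂ X F) ≤ F := sem_min_prefixed X φ ρ₂
    have hle' : Function.update ρ₁ X G ≤ Function.update ρ₂ X F :=
      update_le_update_iff.2 ⟨hGF, fun Y _ => hle Y⟩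
    have hG : (Formula.min X φ).sem ρ₁ ≤ G := by
      refine sem_min_le fun δ t ht => ⟨hF δ (sem_mono φ hle' δ ht), fun m => ?_⟩
      have hK' : Keeps R V _ _ := ih hU.2 hV hM hle' (fun π Y => ?_) (fun Y => ?_)
      · obtain ⟨δ', h₁, h₂⟩ := hK' m δ t ht
        exact ⟨δ', h₁, fun π h => hF δ (h₂ π h)⟩
      · by_cases hY : Y = X
        · subst hY
          simpa using sem_permRel π hU hV (hρ π)
        · simpa [hY] using hρ π Y
      · by_cases hY : Y = X
        · subst hY
          simp only [Function.update_self]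
          exact fun m δ t ht => ht.2 m
        · simpa [hY] using hK Y
    exact fun m δ t ht => (hG δ ht).2 m
  | fvar X => exact hK X

/-! ### Finite memory of deterministic formulae -/

/-- After reading `m` elements there is a data environment, determined by these elements, such that
permuting the rest of a trace of `F` by a permutation that fixes its values on `V` gives a trace
of `F`. -/
def DetKeeps (V : Finset ℕ) (m : ℕ) (F : DInt D) : Prop :=
  ∀ δ w : ℕ → D, ∃ δ' : ℕ → D, ∀ t ∈ F δ, (∀ p < m, t p = w p) →
    ∀ π : Equiv.Perm D, (∀ x ∈ V, π (δ' x) = δ' x) → splice m t (π ∘ t) ∈ F δ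

theorem detKeeps_zero {V : Finset ℕ} {F : DInt D} (h : ∀ π, PermRel V π F F) :
    DetKeeps V 0 F := by
  refine fun δ w => ⟨δ, fun t ht _ π hπ => ?_⟩
  rw [splice_zero]
  exact h π δ δ (fun x hx => (hπ x hx).symm) t ht

theorem Formula.exists_disjunct {φ : Formula} {ρ : ℕ → DInt D} {δ t : ℕ → D}
    (h : t ∈ φ.sem ρ δ) : ∃ χ ∈ φ.disjuncts, t ∈ χ.sem ρ δ := by
  induction φ with
  | or φ ψ ih₁ ih₂ =>
    rcases h with h | h
    · obtain ⟨χ, h₁, h₂⟩ := ih₁ h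
      exact ⟨χ, List.mem_append_left _ h₁, h₂⟩
    · obtain ⟨χ, h₁, h₂⟩ := ih₂ h
      exact ⟨χ, List.mem_append_right _ h₁, h₂⟩
  | _ => exact ⟨_, List.mem_singleton_self _, h⟩

theorem mem_sem_matchEx {x : ℕ} {b : BExp} {ψ : Formula} {ρ : ℕ → DInt D} {δ t : ℕ → D} :
    t ∈ (matchEx x b ψ).sem ρ δ ↔ b.Holds (Function.update δ x (t 0)) (t 0) ∧
      tail t ∈ ψ.sem ρ (Function.update δ x (t 0)) := by
  constructor
  · intro h
    obtain ⟨d, hd⟩ := Set.mem_iUnion.1 h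
    have : d = t 0 := by simpa [BExp.Holds, DExp.eval] using hd.1.1
    subst this
    exact ⟨hd.1.2, hd.2⟩
  · intro h
    exact Set.mem_iUnion.2 ⟨t 0, ⟨by simp [BExp.Holds, DExp.eval], h.1⟩, h.2⟩

/-- The shared variable `x` is matched with the first element, so two traces with the same first
element would satisfy two incompatible constraints under one environment. -/
theorem Formula.IsDetDisj.exclusive {φ ψ : Formula} (h : (Formula.or φ ψ).IsDetDisj D)
    {ρ : ℕ → DInt D} {δ t u : ℕ → D} (ht : t ∈ φ.sem ρ δ) (hu : u ∈ ψ.sem ρ δ) :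
    t 0 ≠ u 0 := by
  intro e
  obtain ⟨x, l, hl, hp⟩ := h
  obtain ⟨l₁, l₂, rfl, e₁, e₂⟩ := List.append_eq_map_iff.1 (show φ.disjuncts ++ ψ.disjuncts = _ from hl)
  obtain ⟨χ₁, m₁, s₁⟩ := exists_disjunct ht
  obtain ⟨χ₂, m₂, s₂⟩ := exists_disjunct hu
  rw [← e₁] at m₁
  rw [← e₂] at m₂
  obtain ⟨p, hp₁, rfl⟩ := List.mem_map.1 m₁
  obtain ⟨q, hq₁, rfl⟩ := List.mem_map.1 m₂
  exact (List.pairwise_append.1 hp).2.2 p hp₁ q hq₁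
    ⟨_, _, (mem_sem_matchEx.1 s₁).1, e ▸ (mem_sem_matchEx.1 s₂).1⟩

/-- Matched quantifiers and exclusive disjunctions leave no choice, so the environment reached
depends only on `δ` and the elements read. Recursion is handled by induction on `m`: a guarded
variable is consulted only after an element has been consumed, hence at smaller `m`. For this reason
level `m` is assumed only for unguarded variables. -/
theorem Formula.sem_detKeeps {V : Finset ℕ} {φ : Formula}
    (hU : φ.Uses {.tt, .min, .ex, .dia, .or}) (hV : φ.dataVars ⊆ V) (hM : φ.IsMatch)
    (hD : φ.DisjDet D) (hg : φ.Guarded) {m : ℕ} {ρ : ℕ → DInt D}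
    (hρ : ∀ π X, PermRel V π (ρ X) (ρ X)) (hlt : ∀ X, ∀ k < m, DetKeeps V k (ρ X))
    (hm : ∀ X ∈ φ.unguarded, DetKeeps V m (ρ X)) : DetKeeps V m (φ.sem ρ) := by
  induction φ generalizing m ρ with
  | tt => exact fun δ _ => ⟨δ, fun _ _ _ _ _ => trivial⟩
  | ff | box | all | and | max => simp [Formula.Uses] at hU
  | dia b φ ih =>
    cases m with
    | zero => exact detKeeps_zero fun π => sem_permRel π hU hV (hρ π)
    | succ m =>
      intro δ w
      obtain ⟨δ', h⟩ := ih hU.2 (Finset.union_subset_iff.1 hV).2 hM hD hg hρ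
        (fun X k hk => hlt X k (by omega)) (fun X _ => hlt X m (by omega)) δ (tail w)
      refine ⟨δ', fun t ht hw π hπ => ⟨by simpa using ht.1, ?_⟩⟩
      rw [tail_splice, tail_comp]
      exact h _ ht.2 (fun p hp => hw (p + 1) (by omega)) π hπ
  | ex x φ ih =>
    cases m with
    | zero => exact detKeeps_zero fun π => sem_permRel π hU hV (hρ π)
    | succ m =>
      intro δ w
      obtain ⟨δ', h⟩ := ih hU.2 hV hM.2 hD hg hρ hlt hm (Function.update δ x (w 0)) w
      refine ⟨δ', fun t ht hw π hπ => ?_⟩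
      obtain ⟨d, hd⟩ := Set.mem_iUnion.1 ht
      have := matchEx_holds hM hd
      rw [hw 0 (by omega)] at this
      subst this
      exact Set.mem_iUnion.2 ⟨_, h t hd hw π hπ⟩
  | or φ ψ ih₁ ih₂ =>
    cases m with
    | zero => exact detKeeps_zero fun π => sem_permRel π hU hV (hρ π)
    | succ m =>
      obtain ⟨v₁, v₂⟩ := Finset.union_subset_iff.1 hV
      intro δ w
      -- The first element `w 0` selects the disjunct for all traces that start with it, so `δ'` can
      -- be fixed before `t`.
      by_cases hφ : ∃ t ∈ φ.sem ρ δ, t 0 = w 0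
      · obtain ⟨s, hs, hs0⟩ := hφ
        obtain ⟨δ', h⟩ := ih₁ hU.2.1 v₁ hM.1 hD.2.1 hg.1 hρ hlt (fun X hX => hm X (.inl hX)) δ w
        refine ⟨δ', fun t ht hw π hπ => .inl (h t (ht.resolve_right fun ht' => ?_) hw π hπ)⟩
        exact hD.1.exclusive hs ht' (hs0.trans (hw 0 (by omega)).symm)
      · obtain ⟨δ', h⟩ := ih₂ hU.2.2 v₂ hM.2 hD.2.2 hg.2 hρ hlt (fun X hX => hm X (.inr hX)) δ w
        refine ⟨δ', fun t ht hw π hπ => .inr (h t (ht.resolve_left fun ht' => ?_) hw π hπ)⟩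
        exact hφ ⟨t, ht', hw 0 (by omega)⟩
  | min X φ ih =>
    induction m using Nat.strong_induction_on with
    | _ m ihm =>
      have key : ∀ k < m, DetKeeps V k ((Formula.min X φ).sem ρ) := fun k hk =>
        ihm k hk (fun Y j hj => hlt Y j (hj.trans hk)) (fun Y _ => hlt Y k hk)
      -- After one unfolding, guardedness of `X` means that only `key`, at levels below `m`, is
      -- needed for `X`.
      rw [← sem_min_eq]
      refine ih hU.2 hV hM hD hg.2 (fun π Y => ?_) (fun Y k hk => ?_) (fun Y hY => ?_)
      · by_cases hY : Y = X
        · subst hY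
          simpa using sem_permRel π hU hV (hρ π)
        · simpa [hY] using hρ π Y
      · by_cases hY : Y = X
        · subst hY
          simpa using key k hk
        · simpa [hY] using hlt Y k hk
      · have hne : Y ≠ X := fun e => hg.1 (e ▸ hY)
        simpa [hne] using hm Y ⟨hY, hne⟩
  | fvar X => exact hm X rfl

/-! ### Formulae without fixed points, and formulae without greatest fixed points -/

theorem Formula.exists_lookahead {φ : Formula} (hU : φ.Uses {.tt, .ex, .dia, .or})
    (hr : φ.freeRec = ∅) : ∃ n, ∀ (ρ : ℕ → DInt D) (δ t u : ℕ → D), (∀ p < n, t p = u p) →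
      t ∈ φ.sem ρ δ → u ∈ φ.sem ρ δ := by
  induction φ with
  | tt => exact ⟨0, fun _ _ _ _ _ _ => trivial⟩
  | ff | box | all | and | max | min => simp [Formula.Uses] at hU
  | dia b φ ih =>
    obtain ⟨n, h⟩ := ih hU.2 hr
    refine ⟨n + 1, fun ρ δ t u htu ht => ⟨htu 0 (by omega) ▸ ht.1, ?_⟩⟩
    exact h ρ δ _ _ (fun p hp => htu (p + 1) (by omega)) ht.2
  | ex x φ ih =>
    obtain ⟨n, h⟩ := ih hU.2 hr
    refine ⟨n, fun ρ δ t u htu ht => ?_⟩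
    obtain ⟨d, hd⟩ := Set.mem_iUnion.1 ht
    exact Set.mem_iUnion.2 ⟨d, h _ _ t u htu hd⟩
  | or φ ψ ih₁ ih₂ =>
    obtain ⟨r₁, r₂⟩ := Set.union_empty_iff.1 hr
    obtain ⟨n₁, h₁⟩ := ih₁ hU.2.1 r₁
    obtain ⟨n₂, h₂⟩ := ih₂ hU.2.2 r₂
    refine ⟨n₁ + n₂, fun ρ δ t u htu ht => ht.imp ?_ ?_⟩
    · exact h₁ ρ δ t u fun p hp => htu p (by omega)
    · exact h₂ ρ δ t u fun p hp => htu p (by omega)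
  | fvar X => exact absurd hr (Set.singleton_ne_empty X)

/-- Membership is decided by a finite prefix. -/
def PrefixOpen (F : DInt D) : Prop :=
  ∀ δ, ∀ t ∈ F δ, ∃ n, ∀ u : ℕ → D, (∀ p < n, t p = u p) → u ∈ F δ

/-- Openness survives arbitrary unions and finite intersections. For `min`, the interior of the
fixed point is itself a prefixed point, so the fixed point equals its interior. -/
theorem Formula.sem_prefixOpen {φ : Formula} (hU : φ.Uses {.tt, .min, .ex, .dia, .or, .and})
    {ρ : ℕ → DInt D} (hρ : ∀ X, PrefixOpen (ρ X)) : PrefixOpen (φ.sem ρ) := by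
  induction φ generalizing ρ with
  | tt => exact fun _ _ _ => ⟨0, fun _ _ => trivial⟩
  | ff | box | all | max => simp [Formula.Uses] at hU
  | dia b φ ih =>
    intro δ t ht
    obtain ⟨n, h⟩ := ih hU.2 hρ δ _ ht.2
    refine ⟨n + 1, fun u htu => ⟨htu 0 (by omega) ▸ ht.1, ?_⟩⟩
    exact h _ fun p hp => htu (p + 1) (by omega)
  | ex x φ ih =>
    intro δ t ht
    obtain ⟨d, hd⟩ := Set.mem_iUnion.1 ht
    obtain ⟨n, h⟩ := ih hU.2 hρ _ t hd
    exact ⟨n, fun u htu => Set.mem_iUnion.2 ⟨d, h u htu⟩⟩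
  | or φ ψ ih₁ ih₂ =>
    rintro δ t (ht | ht)
    · obtain ⟨n, h⟩ := ih₁ hU.2.1 hρ δ t ht
      exact ⟨n, fun u htu => .inl (h u htu)⟩
    · obtain ⟨n, h⟩ := ih₂ hU.2.2 hρ δ t ht
      exact ⟨n, fun u htu => .inr (h u htu)⟩
  | and φ ψ ih₁ ih₂ =>
    intro δ t ht
    obtain ⟨n₁, h₁⟩ := ih₁ hU.2.1 hρ δ t ht.1
    obtain ⟨n₂, h₂⟩ := ih₂ hU.2.2 hρ δ t ht.2
    exact ⟨n₁ + n₂, fun u htu =>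
      ⟨h₁ u fun p hp => htu p (by omega), h₂ u fun p hp => htu p (by omega)⟩⟩
  | min X φ ih =>
    let F := (Formula.min X φ).sem ρ
    let G : DInt D := fun δ => {t | ∃ n, ∀ u : ℕ → D, (∀ p < n, t p = u p) → u ∈ F δ}
    have hGF : G ≤ F := fun δ t ⟨n, h⟩ => h t fun _ _ => rfl
    have hG : PrefixOpen G := by
      rintro δ t ⟨n, h⟩
      exact ⟨n, fun u htu => ⟨n, fun v huv => h v fun p hp => (htu p hp).trans (huv p hp)⟩⟩
    have hFG : F ≤ G := by
      refine sem_min_le fun δ t ht => ?_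
      have hO : PrefixOpen _ := ih hU.2 (ρ := Function.update ρ X G) (fun Y => ?_)
      · obtain ⟨n, h⟩ := hO δ t ht
        exact ⟨n, fun u htu =>
          sem_min_prefixed X φ ρ δ (sem_mono φ (update_mono ρ X hGF) δ (h u htu))⟩
      · by_cases hY : Y = X
        · subst hY; simpa using hG
        · simpa [hY] using hρ Y
    exact fun δ t ht => hFG δ ht
  | fvar X => exact hρ X

/-! ### Semantics of the separating formulae -/

/-- The value of `x` occurs in the trace; `y` is an auxiliary data variable. -/
def occurs (x y : ℕ) : Formula :=
  .min 0 (.or (matchEx y (.eq (.var y) (.var x)) .tt)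
    (matchEx y (.neg (.eq (.var y) (.var x))) (.fvar 0)))

theorem mem_sem_occurs {x y : ℕ} (hxy : x ≠ y) {ρ : ℕ → DInt D} {δ t : ℕ → D} :
    t ∈ (occurs x y).sem ρ δ ↔ ∃ n, t n = δ x := by
  have step : ∀ (F : DInt D) (δ t : ℕ → D),
      t ∈ (Formula.or (matchEx y (.eq (.var y) (.var x)) .tt)
        (matchEx y (.neg (.eq (.var y) (.var x))) (.fvar 0))).sem (Function.update ρ 0 F) δ ↔
      t 0 = δ x ∨ t 0 ≠ δ x ∧ tail t ∈ F (Function.update δ y (t 0)) := by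
    intro F δ t
    simp only [Formula.sem, Set.mem_union, mem_sem_matchEx, BExp.Holds, DExp.eval,
      Function.update_self, Function.update_of_ne hxy]
    simp
  constructor
  · intro h
    refine Formula.sem_min_le (F := fun δ => {t | ∃ n, t n = δ x}) (fun δ t ht => ?_) δ h
    rcases (step _ δ t).1 ht with h | ⟨_, n, h⟩
    · exact ⟨0, h⟩
    · exact ⟨n + 1, by rwa [Function.update_of_ne hxy] at h⟩
  · rintro ⟨n, hn⟩
    induction n generalizing δ t with
    | zero => exact Formula.sem_min_prefixed _ _ ρ δ ((step _ δ t).2 (.inl hn))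
    | succ n ih =>
      refine Formula.sem_min_prefixed _ _ ρ δ ((step _ δ t).2 ?_)
      by_cases h : t 0 = δ x
      · exact .inl h
      · exact .inr ⟨h, ih (by rwa [Function.update_of_ne hxy])⟩

/-- The first element of the trace occurs again. -/
def firstRecurs : Formula := matchEx 0 .true (occurs 0 1)

theorem mem_sem_firstRecurs {ρ : ℕ → DInt D} {δ t : ℕ → D} :
    t ∈ firstRecurs.sem ρ δ ↔ ∃ n, t (n + 1) = t 0 := by
  rw [firstRecurs, mem_sem_matchEx, mem_sem_occurs (by decide)]
  simp [BExp.Holds, tail]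

/-- Some element of the trace occurs twice. -/
def someRecurs : Formula :=
  .min 1 (.or (matchEx 0 .true (occurs 0 1)) (matchEx 0 .true (.fvar 1)))

theorem mem_sem_someRecurs {ρ : ℕ → DInt D} {δ t : ℕ → D} :
    t ∈ someRecurs.sem ρ δ ↔ ¬ Function.Injective t := by
  have step : ∀ (F : DInt D) (δ t : ℕ → D),
      t ∈ (Formula.or (matchEx 0 .true (occurs 0 1)) (matchEx 0 .true (.fvar 1))).sem
        (Function.update ρ 1 F) δ ↔
      (∃ n, t (n + 1) = t 0) ∨ tail t ∈ F (Function.update δ 0 (t 0)) := by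
    intro F δ t
    simp only [Formula.sem, Set.mem_union, mem_sem_matchEx, BExp.Holds,
      mem_sem_occurs zero_ne_one]
    simp [tail]
  constructor
  · intro h
    refine Formula.sem_min_le (F := fun _ => {t | ¬ Function.Injective t})
      (fun δ t ht hi => ?_) δ h
    rcases (step _ δ t).1 ht with ⟨n, h⟩ | h
    · exact absurd (hi h) (by omega)
    · exact h fun i j hij => by simpa using hi hij
  · intro h
    obtain ⟨i, j, hij, hne⟩ : ∃ i j, t i = t j ∧ i < j := by
      simp only [Function.Injective, not_forall] at h
      obtain ⟨i, j, h, hne⟩ := h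
      rcases Nat.lt_or_gt_of_ne hne with h' | h'
      · exact ⟨i, j, h, h'⟩
      · exact ⟨j, i, h.symm, h'⟩
    clear h
    induction i generalizing j δ t with
    | zero =>
      obtain ⟨n, rfl⟩ := Nat.exists_eq_add_of_lt hne
      exact Formula.sem_min_prefixed _ _ ρ δ ((step _ δ t).2 (.inl ⟨n, by simpa using hij.symm⟩))
    | succ i ih =>
      obtain ⟨k, rfl⟩ : ∃ k, j = k + 1 := ⟨j - 1, by omega⟩
      exact Formula.sem_min_prefixed _ _ ρ δ
        ((step _ δ t).2 (.inr (ih k hij (by omega))))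

/-- Some element is immediately repeated at its first occurrence. -/
def freshDouble : Formula :=
  .ex 0 (.min 0 (.or (.dia (.neg (.eq .star (.var 0))) (.fvar 0))
    (.dia (.eq .star (.var 0)) (.dia (.eq .star (.var 0)) .tt))))

theorem mem_sem_freshDouble {ρ : ℕ → DInt D} {δ t : ℕ → D} :
    t ∈ freshDouble.sem ρ δ ↔ ∃ n, (∀ i < n, t i ≠ t n) ∧ t (n + 1) = t n := by
  have step : ∀ (F : DInt D) (δ t : ℕ → D),
      t ∈ (Formula.or (.dia (.neg (.eq .star (.var 0))) (.fvar 0))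
        (.dia (.eq .star (.var 0)) (.dia (.eq .star (.var 0)) .tt))).sem
        (Function.update ρ 0 F) δ ↔
      t 0 ≠ δ 0 ∧ tail t ∈ F δ ∨ t 0 = δ 0 ∧ t 1 = δ 0 := by
    intro F δ t
    simp [Formula.sem, BExp.Holds, DExp.eval, tail]
  constructor
  · intro h
    obtain ⟨d, hd⟩ := Set.mem_iUnion.1 h
    obtain ⟨n, h₁, h₂, h₃⟩ := Formula.sem_min_le
      (F := fun δ => {t | ∃ n, (∀ i < n, t i ≠ δ 0) ∧ t n = δ 0 ∧ t (n + 1) = δ 0})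
      (fun δ t ht => by
        rcases (step _ δ t).1 ht with ⟨h₀, n, h₁, h₂⟩ | h
        · refine ⟨n + 1, fun i hi => ?_, h₂⟩
          cases i with
          | zero => exact h₀
          | succ i => exact h₁ i (by omega)
        · exact ⟨0, by simp, h⟩) _ hd
    exact ⟨n, h₂ ▸ h₁, h₃.trans h₂.symm⟩
  · rintro ⟨n, h₁, h₂⟩
    refine Set.mem_iUnion.2 ⟨t n, ?_⟩
    have key : ∀ δ : ℕ → D, (∀ i < n, t i ≠ δ 0) → t n = δ 0 → t (n + 1) = δ 0 →
        t ∈ (Formula.min 0 (.or (.dia (.neg (.eq .star (.var 0))) (.fvar 0))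
          (.dia (.eq .star (.var 0)) (.dia (.eq .star (.var 0)) .tt)))).sem ρ δ := by
      clear h₁ h₂
      intro δ
      induction n generalizing t with
      | zero =>
        exact fun _ h₂ h₃ => Formula.sem_min_prefixed _ _ ρ δ ((step _ δ t).2 (.inr ⟨h₂, h₃⟩))
      | succ n ih =>
        intro h₁ h₂ h₃
        exact Formula.sem_min_prefixed _ _ ρ δ ((step _ δ t).2 (.inl ⟨h₁ 0 (by omega),
          ih (t := tail t) (fun i hi => h₁ (i + 1) (by omega)) h₂ h₃⟩))
    exact key _ (by simpa using h₁) (by simp) (by simpa using h₂)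

/-- The value of the data variable `0` occurs, and that of the data variable `1` does not occur
before. -/
def otherFirst : Formula :=
  .min 1 (.or (.dia (.eq .star (.var 0)) .tt) (.dia (.neg (.eq .star (.var 1))) (.fvar 1)))

theorem mem_sem_otherFirst {ρ : ℕ → DInt D} {δ t : ℕ → D} :
    t ∈ otherFirst.sem ρ δ ↔ ∃ n, t n = δ 0 ∧ ∀ i < n, t i ≠ δ 1 := by
  have step : ∀ (F : DInt D) (t : ℕ → D),
      t ∈ (Formula.or (.dia (.eq .star (.var 0)) .tt)
        (.dia (.neg (.eq .star (.var 1))) (.fvar 1))).sem (Function.update ρ 1 F) δ ↔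
      t 0 = δ 0 ∨ t 0 ≠ δ 1 ∧ tail t ∈ F δ := by
    intro F t
    simp [Formula.sem, BExp.Holds, DExp.eval]
  constructor
  · intro h
    refine Formula.sem_min_le (ρ := ρ) (X := 1) (F := fun δ' => {t | δ' = δ →
      ∃ n, t n = δ 0 ∧ ∀ i < n, t i ≠ δ 1}) (fun δ' t ht e => ?_) δ h rfl
    subst e
    rcases (step _ t).1 ht with h | ⟨h₀, h⟩
    · exact ⟨0, h, by simp⟩
    · obtain ⟨n, h₁, h₂⟩ := h rfl
      refine ⟨n + 1, h₁, fun i hi => ?_⟩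
      cases i with
      | zero => exact h₀
      | succ i => exact h₂ i (by omega)
  · rintro ⟨n, h₁, h₂⟩
    induction n generalizing t with
    | zero => exact Formula.sem_min_prefixed _ _ ρ δ ((step _ t).2 (.inl h₁))
    | succ n ih =>
      exact Formula.sem_min_prefixed _ _ ρ δ ((step _ t).2 (.inr ⟨h₂ 0 (by omega),
        ih (t := tail t) h₁ fun i hi => h₂ (i + 1) (by omega)⟩))

/-- The elements of the trace up to the first occurrence of the value of the data variable `0`
are pairwise distinct. -/
def distinctUntil : Formula :=
  .min 0 (.or (.dia (.eq .star (.var 0)) .tt)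
    (.ex 1 (.dia (.eq .star (.var 1)) (.and (.fvar 0) otherFirst))))

/-- Each unfolding stores the current element in variable `1` and spawns a check that it does not
recur before the target. The recursive branch may then overwrite the variable. -/
theorem mem_sem_distinctUntil {ρ : ℕ → DInt D} {δ t : ℕ → D} :
    t ∈ distinctUntil.sem ρ δ ↔ ∃ n, t n = δ 0 ∧ ∀ i j, i < j → j ≤ n → t i ≠ t j := by
  have step : ∀ (F : DInt D) (δ t : ℕ → D),
      t ∈ (Formula.or (.dia (.eq .star (.var 0)) .tt)
        (.ex 1 (.dia (.eq .star (.var 1)) (.and (.fvar 0) otherFirst)))).sem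
        (Function.update ρ 0 F) δ ↔
      t 0 = δ 0 ∨ tail t ∈ F (Function.update δ 1 (t 0)) ∧
        ∃ n, t (n + 1) = δ 0 ∧ ∀ i < n, t (i + 1) ≠ t 0 := by
    intro F δ t
    simp [Formula.sem, BExp.Holds, DExp.eval, mem_sem_otherFirst, tail]
  constructor
  · intro h
    refine Formula.sem_min_le (F := fun δ => {t | ∃ n, t n = δ 0 ∧
      ∀ i j, i < j → j ≤ n → t i ≠ t j}) (fun δ t ht => ?_) δ h
    rcases (step _ δ t).1 ht with h | ⟨⟨n, h₁, h₂⟩, k, h₃, h₄⟩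
    · exact ⟨0, h, by omega⟩
    -- The two disjuncts overlap. If the target is already at position `0`, that position is the
    -- witness.
    · by_cases h₀ : t 0 = δ 0
      · exact ⟨0, h₀, by omega⟩
      · replace h₁ : t (n + 1) = δ 0 := by simpa [tail] using h₁
        -- The two conjuncts may stop at different occurrences of the target. Distinctness up to `n`
        -- makes `n` the first one in the tail, so the check up to `k` covers it.
        have hnk : n ≤ k := by
          by_contra hlt
          exact h₂ k n (by omega) le_rfl (h₃.trans h₁.symm)
        refine ⟨n + 1, h₁, fun i j hij hj => ?_⟩
        obtain ⟨j, rfl⟩ : ∃ k, j = k + 1 := ⟨j - 1, by omega⟩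
        cases i with
        | zero =>
          rcases Nat.lt_or_ge j n with hjn | hjn
          · exact (h₄ j (by omega)).symm
          · obtain rfl : j = n := by omega
            rwa [h₁]
        | succ i => exact h₂ i j (by omega) (by omega)
  · rintro ⟨n, h₁, h₂⟩
    induction n generalizing t δ with
    | zero => exact Formula.sem_min_prefixed _ _ ρ δ ((step _ δ t).2 (.inl h₁))
    | succ n ih =>
      refine Formula.sem_min_prefixed _ _ ρ δ ((step _ δ t).2 (.inr ⟨?_, n, h₁, fun i hi =>
        (h₂ 0 (i + 1) (by omega) (by omega)).symm⟩))
      exact ih (t := tail t) (by rw [Function.update_of_ne zero_ne_one]; exact h₁)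
        fun i j hij hj => h₂ (i + 1) (j + 1) (by omega) (by omega)

/-- The elements of the trace up to the first recurrence of the first element are pairwise
distinct. -/
def distinctUntilRecurs : Formula := .ex 0 (.dia (.eq .star (.var 0)) distinctUntil)

theorem mem_sem_distinctUntilRecurs {ρ : ℕ → DInt D} {δ t : ℕ → D} :
    t ∈ distinctUntilRecurs.sem ρ δ ↔
      ∃ n, t (n + 1) = t 0 ∧ ∀ i j, i < j → j ≤ n → t (i + 1) ≠ t (j + 1) := by
  simp [distinctUntilRecurs, Formula.sem, BExp.Holds, DExp.eval, mem_sem_distinctUntil, tail]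

/-- All elements of the trace are equal. -/
def constant : Formula := .ex 0 (.max 0 (.dia (.eq .star (.var 0)) (.fvar 0)))

theorem mem_sem_constant {ρ : ℕ → DInt D} {δ t : ℕ → D} :
    t ∈ constant.sem ρ δ ↔ ∃ d, ∀ n, t n = d := by
  have step : ∀ (F : DInt D) (δ t : ℕ → D),
      t ∈ (Formula.dia (.eq .star (.var 0)) (.fvar 0)).sem (Function.update ρ 0 F) δ ↔
      t 0 = δ 0 ∧ tail t ∈ F δ := by
    intro F δ t
    simp [Formula.sem, BExp.Holds, DExp.eval]
  constructor
  · intro h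
    obtain ⟨d, hd⟩ := Set.mem_iUnion.1 h
    refine ⟨d, fun n => ?_⟩
    clear h
    induction n generalizing t with
    | zero => simpa using ((step _ _ t).1 (Formula.sem_max_postfixed _ _ ρ _ hd)).1
    | succ n ih => exact ih (t := tail t) ((step _ _ t).1 (Formula.sem_max_postfixed _ _ ρ _ hd)).2
  · rintro ⟨d, hd⟩
    refine Set.mem_iUnion.2 ⟨d, ?_⟩
    refine Formula.le_sem_max (F := fun δ => {t | ∀ n, t n = δ 0}) (fun δ t ht => ?_) _
      (by simpa using hd)
    exact (step _ δ t).2 ⟨ht 0, fun n => ht (n + 1)⟩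

/-! ### Inclusions -/

theorem Formula.Uses.mono {C C' : Set Construct} (h : C ⊆ C') {φ : Formula} (hU : φ.Uses C) :
    φ.Uses C' := by
  induction φ with
  | tt | ff => exact h hU
  | dia _ _ ih | box _ _ ih | ex _ _ ih | all _ _ ih | min _ _ ih | max _ _ ih =>
    exact ⟨h hU.1, ih hU.2⟩
  | or _ _ ih₁ ih₂ | and _ _ ih₁ ih₂ => exact ⟨h hU.1, ih₁ hU.2.1, ih₂ hU.2.2⟩
  | fvar => trivial

theorem ExpressibleIn.of_subset {L₁ L₂ : Set Formula} (h : L₁ ⊆ L₂) : ExpressibleIn D L₁ L₂ :=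
  fun φ hφ => ⟨φ, h hφ, fun _ _ => rfl⟩

theorem ExpressibleIn.trans {L₁ L₂ L₃ : Set Formula} (h₁ : ExpressibleIn D L₁ L₂)
    (h₂ : ExpressibleIn D L₂ L₃) : ExpressibleIn D L₁ L₃ := by
  intro φ hφ
  obtain ⟨ψ, hψ, e⟩ := h₁ φ hφ
  obtain ⟨χ, hχ, e'⟩ := h₂ ψ hψ
  exact ⟨χ, hχ, fun ρ δ => (e ρ δ).trans (e' ρ δ)⟩

theorem StrictlyLess.trans {L₁ L₂ L₃ : Set Formula} (h₁ : StrictlyLess D L₁ L₂)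
    (h₂ : StrictlyLess D L₂ L₃) : StrictlyLess D L₁ L₃ :=
  ⟨h₁.1.trans h₂.1, fun h => h₁.2 (h₂.1.trans h)⟩

theorem HMLd_mono {C C' : Set Construct} (h : C ⊆ C') : HMLd C ⊆ HMLd C' :=
  fun _ hφ => ⟨hφ.1, hφ.2.mono h⟩

theorem HMLdDet_mono {C C' : Set Construct} (h : C ⊆ C') : HMLdDet D C ⊆ HMLdDet D C' :=
  fun _ hφ => ⟨⟨HMLd_mono h hφ.1.1, hφ.1.2⟩, hφ.2⟩

theorem HMLd_all :
    HMLd {.tt, .ff, .min, .max, .ex, .all, .dia, .box, .or, .and} = recHMLd := by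
  refine Set.Subset.antisymm (fun φ h => h.1) fun φ h => ⟨h, ?_⟩
  clear h
  induction φ with
  | tt | ff | fvar => simp [Formula.Uses]
  | dia _ _ ih | box _ _ ih | ex _ _ ih | all _ _ ih | min _ _ ih | max _ _ ih =>
    exact ⟨by simp, ih⟩
  | or _ _ ih₁ ih₂ | and _ _ ih₁ ih₂ => exact ⟨by simp, ih₁, ih₂⟩

/-! ### Separations -/

/-- Used with `S` the set of stored values: any window of `k + 1` indices contains a forgotten one.
-/
theorem exists_notMem_of_card_le {k : ℕ} {S : Finset D} (hS : S.card ≤ k) (e : ℕ ↪ D) (a : ℕ) :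
    ∃ j, a ≤ j ∧ j ≤ a + k ∧ e j ∉ S := by
  obtain ⟨d, hd, hdS⟩ := Finset.exists_mem_notMem_of_card_lt_card
    (s := S) (t := (Finset.Icc a (a + k)).map e) (by simp; omega)
  obtain ⟨j, hj, rfl⟩ := Finset.mem_map.1 hd
  exact ⟨j, (Finset.mem_Icc.1 hj).1, (Finset.mem_Icc.1 hj).2, hdS⟩

theorem swap_fixes [DecidableEq D] {V : Finset ℕ} {δ : ℕ → D} {a b : D}
    (ha : a ∉ V.image δ) (hb : b ∉ V.image δ) : ∀ x ∈ V, Equiv.swap a b (δ x) = δ x := by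
  intro x hx
  have := Finset.mem_image_of_mem δ hx
  exact Equiv.swap_apply_of_ne_of_ne (fun h => ha (h ▸ this)) (fun h => hb (h ▸ this))

theorem firstRecurs_mem : firstRecurs ∈ HMLdDet D {.tt, .min, .ex, .dia, .or} := by
  refine ⟨⟨⟨⟨?_, ?_, ?_⟩, ?_⟩, ?_⟩, ?_⟩
  · simp [firstRecurs, occurs, matchEx, Formula.freeData, BExp.vars, DExp.vars]
  · simp [firstRecurs, occurs, matchEx, Formula.freeRec]
  · simp [firstRecurs, occurs, matchEx, Formula.Guarded, Formula.unguarded]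
  · simp [firstRecurs, occurs, matchEx, Formula.Uses]
  · simp [firstRecurs, occurs, matchEx, Formula.IsMatch]
  · simp only [firstRecurs, occurs, matchEx, Formula.DisjDet, and_true]
    refine ⟨1, [(.eq (.var 1) (.var 0), .tt), (.neg (.eq (.var 1) (.var 0)), .fvar 0)], rfl, ?_⟩
    simp [BExp.Satisfiable, BExp.Holds]

theorem someRecurs_mem : someRecurs ∈ HMLdMatch {.tt, .min, .ex, .dia, .or} := by
  refine ⟨⟨⟨?_, ?_, ?_⟩, ?_⟩, ?_⟩
  · simp [someRecurs, occurs, matchEx, Formula.freeData, BExp.vars, DExp.vars]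
  · simp [someRecurs, occurs, matchEx, Formula.freeRec]
  · simp [someRecurs, occurs, matchEx, Formula.Guarded, Formula.unguarded]
  · simp [someRecurs, occurs, matchEx, Formula.Uses]
  · simp [someRecurs, occurs, matchEx, Formula.IsMatch]

theorem freshDouble_mem : freshDouble ∈ HMLd {.tt, .min, .ex, .dia, .or} := by
  refine ⟨⟨?_, ?_, ?_⟩, ?_⟩
  · simp [freshDouble, Formula.freeData, BExp.vars, DExp.vars]
  · simp [freshDouble, Formula.freeRec]
  · simp [freshDouble, Formula.Guarded, Formula.unguarded]
  · simp [freshDouble, Formula.Uses]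

theorem distinctUntilRecurs_mem :
    distinctUntilRecurs ∈ HMLd {.tt, .min, .ex, .dia, .or, .and} := by
  refine ⟨⟨?_, ?_, ?_⟩, ?_⟩
  · ext x
    simp [distinctUntilRecurs, distinctUntil, otherFirst, Formula.freeData, BExp.vars, DExp.vars]
  · simp [distinctUntilRecurs, distinctUntil, otherFirst, Formula.freeRec]
  · simp [distinctUntilRecurs, distinctUntil, otherFirst, Formula.Guarded, Formula.unguarded]
  · simp [distinctUntilRecurs, distinctUntil, otherFirst, Formula.Uses]

theorem constant_mem : constant ∈ recHMLd := by
  refine ⟨?_, ?_, ?_⟩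
  · simp [constant, Formula.freeData, BExp.vars, DExp.vars]
  · simp [constant, Formula.freeRec]
  · simp [constant, Formula.Guarded, Formula.unguarded]

theorem firstRecurs_not_expressible [Infinite D] {φ : Formula}
    (hφ : φ ∈ HMLdDet D {.tt, .ex, .dia, .or}) : ¬ Equivalent D firstRecurs φ := by
  intro h
  let e : ℕ ↪ D := Infinite.natEmbedding D
  obtain ⟨n, hn⟩ := Formula.exists_lookahead (D := D) hφ.1.1.2 hφ.1.1.1.2.1
  -- The first element recurs only beyond the lookahead, where the trace may be replaced by the
  -- injective `e`.
  have key := hn (fun _ => ⊥) e (fun p => if p < n + 1 then e p else e 0) e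
    (fun p hp => if_pos (by omega))
  rw [← h, mem_sem_firstRecurs, mem_sem_firstRecurs] at key
  obtain ⟨k, hk⟩ := key ⟨n, by simp⟩
  simpa using e.injective hk

theorem someRecurs_not_expressible [Infinite D] {φ : Formula}
    (hφ : φ ∈ HMLdDet D {.tt, .min, .ex, .dia, .or}) : ¬ Equivalent D someRecurs φ := by
  classical
  intro h
  let e : ℕ ↪ D := Infinite.natEmbedding D
  let k := φ.dataVars.card
  let m := k + 1
  obtain ⟨δ', hδ'⟩ := Formula.sem_detKeeps (D := D) (V := φ.dataVars) (m := m)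
    (ρ := fun _ => ⊥) hφ.1.1.2 subset_rfl hφ.1.2 hφ.2 hφ.1.1.1.2.2
    (fun _ _ _ _ _ _ h => h.elim) (fun _ _ _ δ _ => ⟨δ, fun _ h => h.elim⟩)
    (fun _ _ δ _ => ⟨δ, fun _ h => h.elim⟩) e e
  obtain ⟨j, -, hj, hjS⟩ := exists_notMem_of_card_le (Finset.card_image_le (s := φ.dataVars)
    (f := δ')) e 0
  obtain ⟨f, hf₁, hf₂, hfS⟩ := exists_notMem_of_card_le (Finset.card_image_le (s := φ.dataVars)
    (f := δ')) e m
  rw [← h] at hδ'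
  -- The trace is chosen after `δ'`, since it repeats the forgotten `e j` right after the prefix.
  -- Later indices are at least `m + k + 2 > f`, so swapping `e j` with `e f` on the suffix makes
  -- the trace injective.
  have key := hδ' (fun p => e (if p < m then p else if p = m then j else p + k + 1))
    (mem_sem_someRecurs.2 fun hi => by
      have := e.injective.eq_iff.1 (congrArg e (hi (a₁ := j) (a₂ := m) (by
        simp [show j < m by omega])))
      omega)
    (fun p hp => by simp [hp]) (Equiv.swap (e j) (e f)) (swap_fixes hjS hfS)
  refine mem_sem_someRecurs.1 key ?_
  have : splice m (fun p => e (if p < m then p else if p = m then j else p + k + 1))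
      (Equiv.swap (e j) (e f) ∘
        fun p => e (if p < m then p else if p = m then j else p + k + 1)) =
      fun p => e (if p < m then p else if p = m then f else p + k + 1) := by
    funext p
    simp only [splice, Function.comp]
    split_ifs with h₁ h₂
    · rfl
    · exact Equiv.swap_apply_left _ _
    · exact Equiv.swap_apply_of_ne_of_ne (fun h => by have := e.injective h; omega)
        (fun h => by have := e.injective h; omega)
  rw [this]
  intro p q hpq
  have := e.injective hpq
  split_ifs at this <;> omega

theorem freshDouble_not_expressible [Infinite D] {φ : Formula}
    (hφ : φ ∈ HMLdMatch {.tt, .min, .ex, .dia, .or}) : ¬ Equivalent D freshDouble φ := by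
  classical
  intro h
  let e : ℕ ↪ D := Infinite.natEmbedding D
  let k := φ.dataVars.card
  let m := k + 2
  -- The trace `e 0, …, e (m - 1), e m, e m, e (m + 1), …`, whose only double is fresh and lies just
  -- after the prefix of length `m`.
  let t : ℕ → D := fun p => e (if p ≤ m then p else p - 1)
  have ht : t ∈ freshDouble.sem (fun _ => ⊥) (fun _ => e 0) := by
    refine mem_sem_freshDouble.2 ⟨m, fun i hi he => ?_, by simp [t]⟩
    have := e.injective he
    split_ifs at this <;> omega
  have hK := Formula.sem_keeps (D := D) (R := True) (V := φ.dataVars) (ρ₁ := fun _ => ⊥)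
    (ρ₂ := fun _ => ⊥) hφ.1.2 subset_rfl (fun _ => hφ.2) le_rfl
    (fun _ _ _ _ _ _ h => h.elim) (fun _ _ _ _ h => h.elim)
  rw [h] at ht
  obtain ⟨δ', hδ₁, hδ₂⟩ := hK m _ t ht
  rw [← h] at hδ₂
  obtain ⟨j, -, hj, hjS⟩ := exists_notMem_of_card_le (Finset.card_image_le (s := φ.dataVars)
    (f := δ')) e 0
  -- Matching enters here: every stored value is `e 0` or was read in the prefix. Swapping `e m`
  -- with a forgotten `e j`, `j ≤ k < m`, makes the double stale.
  have hmS : e m ∉ φ.dataVars.image δ' := by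
    intro hm
    obtain ⟨x, hx, hxm⟩ := Finset.mem_image.1 hm
    rcases hδ₁ trivial x hx with ⟨_, _, h'⟩ | ⟨p, hp, h'⟩
    · have := e.injective (hxm.symm.trans h')
      omega
    · have := e.injective (hxm.symm.trans h')
      split_ifs at this <;> omega
  have key := hδ₂ _ (swap_fixes hjS hmS)
  have : splice m t (Equiv.swap (e j) (e m) ∘ t) =
      fun p => e (if p < m then p else if p ≤ m + 1 then j else p - 1) := by
    funext p
    simp only [splice, Function.comp, t]
    by_cases h₁ : p < m
    · simp [h₁, h₁.le]
    · by_cases h₂ : p ≤ m + 1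
      · have : (if p ≤ m then p else p - 1) = m := by split_ifs <;> omega
        simp [h₁, h₂, this]
      · rw [if_neg h₁, if_neg h₁, if_neg h₂, if_neg (by omega)]
        exact Equiv.swap_apply_of_ne_of_ne (fun h => by have := e.injective h; omega)
          (fun h => by have := e.injective h; omega)
  rw [this, mem_sem_freshDouble] at key
  obtain ⟨n, h₁, h₂⟩ := key
  have h₂ := e.injective h₂
  have h₁ := fun hn => mt (congrArg e) (h₁ j hn)
  split_ifs at h₁ h₂ <;> omega

theorem distinctUntilRecurs_not_expressible [Infinite D] {φ : Formula}
    (hφ : φ ∈ HMLd {.tt, .min, .ex, .dia, .or}) : ¬ Equivalent D distinctUntilRecurs φ := by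
  classical
  intro h
  let e : ℕ ↪ D := Infinite.natEmbedding D
  let k := φ.dataVars.card
  let m := k + 2
  let l := 2 * m
  -- The first element returns at `l = 2 * m`. This leaves room for a forgotten value at an index
  -- `i` in `[1, m)`, already read, and another at an index `j` in `[m, l)`, still to come.
  let t : ℕ → D := fun p => e (if p = l then 0 else p)
  have ht : t ∈ distinctUntilRecurs.sem (fun _ => ⊥) (fun _ => e 0) := by
    refine mem_sem_distinctUntilRecurs.2 ⟨l - 1, ?_, fun i j hij hj he => ?_⟩
    · simp [t, show l - 1 + 1 = l by omega]
    · have := e.injective he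
      split_ifs at this <;> omega
  have hK := Formula.sem_keeps (D := D) (R := False) (V := φ.dataVars) (ρ₁ := fun _ => ⊥)
    (ρ₂ := fun _ => ⊥) hφ.2 subset_rfl False.elim le_rfl
    (fun _ _ _ _ _ _ h => h.elim) (fun _ _ _ _ h => h.elim)
  rw [h] at ht
  obtain ⟨δ', -, hδ⟩ := hK m _ t ht
  rw [← h] at hδ
  obtain ⟨i, hi₁, hi₂, hiS⟩ := exists_notMem_of_card_le (Finset.card_image_le
    (s := φ.dataVars) (f := δ')) e 1
  obtain ⟨j, hj₁, hj₂, hjS⟩ := exists_notMem_of_card_le (Finset.card_image_le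
    (s := φ.dataVars) (f := δ')) e m
  -- The swap puts `e i` at position `j`, so `e i` occurs at both `i` and `j`, while `e 0` does not
  -- return before `j`.
  have key := hδ _ (swap_fixes hiS hjS)
  obtain ⟨n, h₁, h₂⟩ := mem_sem_distinctUntilRecurs.1 key
  have hpre : ∀ p < m, splice m t (Equiv.swap (e i) (e j) ∘ t) p = e p := by
    intro p hp
    simp [splice, hp, t, show p ≠ l by omega]
  have hmid : ∀ p, p ≠ j → m ≤ p → p < l →
      splice m t (Equiv.swap (e i) (e j) ∘ t) p = e p := by
    intro p hpj hp hpl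
    simp only [splice, not_lt.2 hp, if_false, Function.comp, t, hpl.ne]
    exact Equiv.swap_apply_of_ne_of_ne (fun h => by have := e.injective h; omega)
        (fun h => by have := e.injective h; omega)
  have hj : splice m t (Equiv.swap (e i) (e j) ∘ t) j = e i := by
    simp [splice, not_lt.2 hj₁, t, show j ≠ l by omega]
  rw [hpre 0 (by omega)] at h₁
  by_cases hnj : n + 1 < j
  · by_cases hnm : n + 1 < m
    · rw [hpre _ hnm] at h₁
      exact absurd (e.injective h₁) (by omega)
    · rw [hmid _ (by omega) (by omega) (by omega)] at h₁
      exact absurd (e.injective h₁) (by omega)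
  · refine h₂ (i - 1) (j - 1) (by omega) (by omega) ?_
    rw [show i - 1 + 1 = i by omega, show j - 1 + 1 = j by omega, hj, hpre i (by omega)]

theorem constant_not_expressible [Infinite D] {φ : Formula}
    (hφ : φ ∈ HMLd {.tt, .min, .ex, .dia, .or, .and}) : ¬ Equivalent D constant φ := by
  intro h
  obtain ⟨a, b, hab⟩ := exists_pair_ne D
  have hO := Formula.sem_prefixOpen (D := D) hφ.2 (ρ := fun _ => ⊥) (fun _ _ _ h => h.elim)
    (fun _ => a) (fun _ => a) (by rw [← h]; exact mem_sem_constant.2 ⟨a, fun _ => rfl⟩)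
  obtain ⟨n, hn⟩ := hO
  rw [← h] at hn
  obtain ⟨d, hd⟩ := mem_sem_constant.1
    -- The bound `n + 1` rather than `n` ensures that position `0` carries `a` even when `n = 0`.
    (hn (fun p => if p < n + 1 then a else b) (fun p hp => (if_pos (by omega)).symm))
  have h₁ := hd 0
  have h₂ := hd (n + 1)
  simp only [Nat.zero_lt_succ, if_true, lt_irrefl, if_false] at h₁ h₂
  exact hab (h₁.trans h₂.symm)

theorem StrictlyLess.of_witness {L₁ L₂ : Set Formula} (h : L₁ ⊆ L₂) {ψ : Formula} (hψ : ψ ∈ L₂)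
    (hn : ∀ {φ}, φ ∈ L₁ → ¬ Equivalent D ψ φ) : StrictlyLess D L₁ L₂ :=
  ⟨.of_subset h, fun h' => let ⟨_, hφ, e⟩ := h' ψ hψ; hn hφ e⟩

end RecHMLd

theorem mainTheorem12 (D : Type*) [Countable D] [Infinite D] :
    RecHMLd.StrictlyLess D
      (RecHMLd.HMLdDet D {.tt, .ex, .dia, .or})
      (RecHMLd.HMLdDet D {.tt, .min, .ex, .dia, .or}) ∧
    RecHMLd.StrictlyLess D
      (RecHMLd.HMLdDet D {.tt, .min, .ex, .dia, .or})
      (RecHMLd.HMLdMatch {.tt, .min, .ex, .dia, .or}) ∧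
    RecHMLd.StrictlyLess D
      (RecHMLd.HMLdMatch {.tt, .min, .ex, .dia, .or})
      (RecHMLd.HMLd {.tt, .min, .ex, .dia, .or}) ∧
    RecHMLd.StrictlyLess D
      (RecHMLd.HMLd {.tt, .min, .ex, .dia, .or})
      (RecHMLd.HMLd {.tt, .min, .ex, .dia, .or, .and}) ∧
    RecHMLd.StrictlyLess D
      (RecHMLd.HMLd {.tt, .min, .ex, .dia, .or, .and})
      (RecHMLd.HMLd {.tt, .ff, .min, .max, .ex, .all, .dia, .box, .or, .and}) ∧
    RecHMLd.HMLd {.tt, .ff, .min, .max, .ex, .all, .dia, .box, .or, .and} = RecHMLd.recHMLd ∧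
    RecHMLd.StrictlyLess D
      (RecHMLd.HMLdDet D {.tt, .min, .ex, .dia, .or})
      (RecHMLd.HMLd {.tt, .min, .ex, .dia, .or}) ∧
    RecHMLd.StrictlyLess D
      (RecHMLd.HMLdDet D {.tt, .min, .ex, .dia, .or})
      (RecHMLd.HMLd {.tt, .min, .ex, .dia, .or, .and}) := by
  have h₁ : RecHMLd.StrictlyLess D (RecHMLd.HMLdDet D {.tt, .min, .ex, .dia, .or})
      (RecHMLd.HMLdMatch {.tt, .min, .ex, .dia, .or}) :=
    .of_witness (fun _ h => h.1) RecHMLd.someRecurs_mem RecHMLd.someRecurs_not_expressible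
  have h₂ : RecHMLd.StrictlyLess D (RecHMLd.HMLdMatch {.tt, .min, .ex, .dia, .or})
      (RecHMLd.HMLd {.tt, .min, .ex, .dia, .or}) :=
    .of_witness (fun _ h => h.1) RecHMLd.freshDouble_mem RecHMLd.freshDouble_not_expressible
  have h₃ : RecHMLd.StrictlyLess D (RecHMLd.HMLd {.tt, .min, .ex, .dia, .or})
      (RecHMLd.HMLd {.tt, .min, .ex, .dia, .or, .and}) :=
    .of_witness (RecHMLd.HMLd_mono (by intro c; simp; tauto)) RecHMLd.distinctUntilRecurs_mem
      RecHMLd.distinctUntilRecurs_not_expressible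
  refine ⟨.of_witness (RecHMLd.HMLdDet_mono (by intro c; simp; tauto)) RecHMLd.firstRecurs_mem
    RecHMLd.firstRecurs_not_expressible, h₁, h₂, h₃,
    .of_witness (RecHMLd.HMLd_mono (by intro c; simp; tauto))
      (RecHMLd.HMLd_all ▸ RecHMLd.constant_mem) RecHMLd.constant_not_expressible,
    RecHMLd.HMLd_all, h₁.trans h₂, (h₁.trans h₂).trans h₃⟩
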